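/- Let $\mathscr{S}=(\mathscr{S}_{n,\pm})_{n\ge 0}$ be an irreducible subfactor planar algebra, that is, a spherical (shaded) planar $*$-algebra over $\mathbb{C}$ such that $\dim\mathscr{S}_{n,\pm}<\infty$ for all $n$, $\dim\mathscr{S}_{0,\pm}=\dim\mathscr{S}_{1,\pm}=1$, and the Markov trace induces a positive definite inner product on every $\mathscr{S}_{n,\pm}$. Write $\mathscr{S}_n=\mathscr{S}_{n,+}$. For $a,b\in\mathscr{S}_2$ let $a*b\in\mathscr{S}_2$ be the coproduct ($a$ is placed to the left of $b$, the upper right string of $a$ is joined to the upper left string of $b$, and the lower right string of $a$ to the lower left string of $b$), and let $1\boxdot a\in\mathscr{S}_3$ be the one-click (clockwise) rotation of $a$ with one vertical string added on its left, so that $(1\boxdot a)(1\boxdot b)=1\boxdot(a*b)$; put $\mathscr{S}_{1,3}=\{1\boxdot z : z\in\mathscr{S}_2\}$. For self-adjoint $x,y$ write $x\preceq y$ if the support projection of $x$ is a subprojection of the support projection of $y$. A projection $Q\in\mathscr{S}_2$ is called a biprojection if $1\boxdot Q$ is a scalar multiple of a projection in $\mathscr{S}_{1,3}$. Let $P\in\mathscr{S}_2$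 be a projection. Then $P*P\preceq P$ if and only if $(P*P)P=P*P$. If these equivalent conditions hold, then $P$ is a biprojection; conversely, every biprojection $P$ satisfies $P*P\preceq P$. -/

import Mathlib

universe u

/-! Shaded planar tangles. Every planar `n`-tangle can be drawn, up to isotopy, in a rectangle with
`n` boundary points on the top and `n` on the bottom, with the distinguished interval of the
rectangle and of each inner box on the left, and in general position with respect to the height. It
is then read from the top to the bottom as a word of layers. Each layer contains one elementary
piece, with vertical strings on both sides of it. Shadings are Booleans: `false` is unshaded (the
sign `+`), `true` is shaded (the sign `-`). -/

/-- The elementary pieces of a planar tangle whose inner boxes are labelled by the spaces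
`V n s` (`n`-boxes whose distinguished interval lies in a region of shading `s`):
`cap` is `∩` (two strings start), `cup` is `∪` (two strings end), and `box n s x` is an inner box
with `n` strings on the top, `n` strings on the bottom, labelled by `x`. -/
inductive Piece (V : ℕ → Bool → Type u) : Type u
  | cap : Piece V
  | cup : Piece V
  | box (n : ℕ) (s : Bool) (x : V n s) : Piece V

namespace Piece

variable {V : ℕ → Bool → Type u}

/-- The number of strings that meet a piece from above. -/
def top : Piece V → ℕ
  | cap => 0
  | cup => 2
  | box n _ _ => n

/-- The number of strings that leave a piece below. -/
def bot : Piece V → ℕ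
  | cap => 2
  | cup => 0
  | box n _ _ => n

/-- A box must sit in a region whose shading is that of its label. -/
def Shaded (r : Bool) : Piece V → Prop
  | cap => True
  | cup => True
  | box _ s _ => s = r

/-- Reflection in a horizontal line; labels are replaced by their adjoints. -/
def reflect [∀ n s, Star (V n s)] : Piece V → Piece V
  | cap => cup
  | cup => cap
  | box n s x => box n s (star x)

end Piece

/-- A layer: a piece with `pos` vertical strings on its left (and others on its right). -/
structure Layer (V : ℕ → Bool → Type u) : Type u where
  pos : ℕ
  piece : Piece V

/-- `WellFormed s k w m`: the word `w` describes a diagram with `k` strings on the top and `m`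
strings on the bottom in which the leftmost region has shading `s`. The shading alternates from
left to right along each horizontal line. -/
def WellFormed {V : ℕ → Bool → Type u} (s : Bool) : ℕ → List (Layer V) → ℕ → Prop
  | k, [], m => k = m
  | k, l :: w, m =>
      l.pos + l.piece.top ≤ k ∧ l.piece.Shaded (xor s l.pos.bodd) ∧
        WellFormed s (k - l.piece.top + l.piece.bot) w m

/-- Labelled planar `n`-tangles whose distinguished outer interval has shading `s`. -/
structure Tangle (V : ℕ → Bool → Type u) (n : ℕ) (s : Bool) : Type u where
  word : List (Layer V)
  wf : WellFormed s n word n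

/-- The elementary planar isotopies, inside an arbitrary diagram: two pieces that lie side by side
exchange their heights, a zigzag of a string is straightened, a box makes a full turn (its strings
are wound around it by `2n` clicks). -/
inductive Move {V : ℕ → Bool → Type u} : List (Layer V) → List (Layer V) → Prop
  | exchange (u v : List (Layer V)) (i d : ℕ) (A B : Piece V) :
      Move (u ++ [⟨i, A⟩, ⟨i + A.bot + d, B⟩] ++ v) (u ++ [⟨i + A.top + d, B⟩, ⟨i, A⟩] ++ v)
  | zigzag_left (u v : List (Layer V)) (i : ℕ) :
      Move (u ++ [⟨i + 1, .cap⟩, ⟨i, .cup⟩] ++ v) (u ++ v)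
  | zigzag_right (u v : List (Layer V)) (i : ℕ) :
      Move (u ++ [⟨i, .cap⟩, ⟨i + 1, .cup⟩] ++ v) (u ++ v)
  | turn (u v : List (Layer V)) (i n : ℕ) (s : Bool) (x : V n s) :
      Move (u ++ (List.range (2 * n)).map (fun j => ⟨i + n + j, .cap⟩)
          ++ [⟨i + 2 * n, .box n s x⟩]
          ++ (List.range (2 * n)).reverse.map (fun j => ⟨i + j, .cup⟩) ++ v)
        (u ++ [⟨i, .box n s x⟩] ++ v)

/-- A (shaded) planar *-algebra over `ℂ` on the spaces `V n s`: each labelled planar tangle is sent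
to an element of the space of its boundary. This is multilinear in the labels, invariant under
planar isotopy, unital, compatible with the gluing of a tangle into an inner box of another one
(naturality), and compatible with the reflection of tangles. -/
structure PlanarStarAlgebra (V : ℕ → Bool → Type u) [∀ n s, AddCommGroup (V n s)]
    [∀ n s, Module ℂ (V n s)] [∀ n s, StarAddMonoid (V n s)] : Type u where
  Z : {n : ℕ} → {s : Bool} → Tangle V n s → V n s
  map_add : ∀ {n : ℕ} {s : Bool} (T T₁ T₂ : Tangle V n s) (u v : List (Layer V)) (i m : ℕ)
    (t : Bool) (x y : V m t), T.word = u ++ [⟨i, .box m t (x + y)⟩] ++ v →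
    T₁.word = u ++ [⟨i, .box m t x⟩] ++ v → T₂.word = u ++ [⟨i, .box m t y⟩] ++ v →
    Z T = Z T₁ + Z T₂
  map_smul : ∀ {n : ℕ} {s : Bool} (T T₁ : Tangle V n s) (u v : List (Layer V)) (i m : ℕ)
    (t : Bool) (c : ℂ) (x : V m t), T.word = u ++ [⟨i, .box m t (c • x)⟩] ++ v →
    T₁.word = u ++ [⟨i, .box m t x⟩] ++ v → Z T = c • Z T₁
  isotopy : ∀ {n : ℕ} {s : Bool} (T T₁ : Tangle V n s), Move T.word T₁.word → Z T = Z T₁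
  unit : ∀ {n : ℕ} {s : Bool} (T : Tangle V n s) (x : V n s), T.word = [⟨0, .box n s x⟩] → Z T = x
  gluing : ∀ {n m : ℕ} {s t : Bool} (T T₁ : Tangle V n s) (R : Tangle V m t)
    (u v : List (Layer V)) (i : ℕ), T.word = u ++ [⟨i, .box m t (Z R)⟩] ++ v →
    T₁.word = u ++ R.word.map (fun l => ⟨i + l.pos, l.piece⟩) ++ v → Z T = Z T₁
  reflection : ∀ {n : ℕ} {s : Bool} (T T₁ : Tangle V n s),
    T₁.word = T.word.reverse.map (fun l => ⟨l.pos, l.piece.reflect⟩) → Z T₁ = star (Z T)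

section words

variable {V : ℕ → Bool → Type u}

theorem WellFormed.append {s : Bool} {w₁ w₂ : List (Layer V)} {k m p : ℕ}
    (h₁ : WellFormed s k w₁ m) (h₂ : WellFormed s m w₂ p) : WellFormed s k (w₁ ++ w₂) p := by
  induction w₁ generalizing k with
  | nil => exact (show k = m from h₁) ▸ h₂
  | cons l w ih => exact ⟨h₁.1, h₁.2.1, ih h₁.2.2⟩

theorem wellFormed_caps (s : Bool) (n : ℕ) :
    WellFormed (V := V) s 0 ((List.range n).map (fun j => ⟨j, .cap⟩)) (2 * n) := by
  induction n with
  | zero => rfl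
  | succ n ih =>
    rw [List.range_succ, List.map_append]
    refine ih.append ⟨?_, trivial, ?_⟩
    · simp only [Piece.top]; omega
    · simp only [Piece.top, Piece.bot]
      show _ = _
      omega

theorem wellFormed_cups (s : Bool) (n : ℕ) :
    WellFormed (V := V) s (2 * n) ((List.range n).reverse.map (fun j => ⟨j, .cup⟩)) 0 := by
  induction n with
  | zero => rfl
  | succ n ih =>
    rw [List.range_succ, List.reverse_append]
    refine ⟨?_, trivial, ?_⟩
    · simp only [Piece.top]; omega
    · simp only [Piece.top, Piece.bot]
      exact ih

end words

namespace PlanarStarAlgebra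

variable {V : ℕ → Bool → Type u} [∀ n s, AddCommGroup (V n s)] [∀ n s, Module ℂ (V n s)]
  [∀ n s, StarAddMonoid (V n s)]

/-- The value of the empty `0`-tangle. -/
def empty (S : PlanarStarAlgebra V) (s : Bool) : V 0 s :=
  S.Z ⟨[], rfl⟩

/-- The product of two `n`-boxes: `a` is stacked on the top of `b`. -/
def mul (S : PlanarStarAlgebra V) {n : ℕ} {s : Bool} (a b : V n s) : V n s :=
  S.Z ⟨[⟨0, .box n s a⟩, ⟨0, .box n s b⟩], by simp [WellFormed, Piece.top, Piece.bot, Piece.Shaded]⟩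

/-- The unnormalized Markov trace: all `n` strings are closed on the right. -/
def tr (S : PlanarStarAlgebra V) {n : ℕ} {s : Bool} (a : V n s) : V 0 s :=
  S.Z ⟨(List.range n).map (fun j => ⟨j, .cap⟩) ++ ([⟨0, .box n s a⟩] ++
      (List.range n).reverse.map (fun j => ⟨j, .cup⟩)),
    (wellFormed_caps s n).append (WellFormed.append (m := 2 * n)
      (by simp [WellFormed, Piece.top, Piece.bot, Piece.Shaded]; omega) (wellFormed_cups s n))⟩

/-- The left trace of a `1`-box: its string is closed on the left, so that the outer region
has the opposite shading. -/
def leftTr (S : PlanarStarAlgebra V) {s : Bool} (a : V 1 s) : V 0 (!s) :=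
  S.Z ⟨[⟨0, .cap⟩, ⟨1, .box 1 s a⟩, ⟨0, .cup⟩],
    by simp [WellFormed, Piece.top, Piece.bot, Piece.Shaded]⟩

/-- A subfactor planar algebra: all spaces are finite dimensional, the spaces of `0`-boxes have
dimension one (and so are identified with `ℂ` through the empty tangle), the algebra is spherical
(left and right traces agree, as scalars), and the Markov trace induces a positive definite
inner product `⟨x, y⟩ = tr (x* y)`. -/
structure IsSubfactor (S : PlanarStarAlgebra V) : Prop where
  finite : ∀ n s, Module.Finite ℂ (V n s)
  dim_zero : ∀ s, Module.finrank ℂ (V 0 s) = 1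
  spherical : ∀ (s : Bool) (x : V 1 s) (c : ℂ),
    S.tr x = c • S.empty s ↔ S.leftTr x = c • S.empty (!s)
  pos_def : ∀ (n : ℕ) (s : Bool) (x : V n s), x ≠ 0 →
    ∃ r : ℝ, 0 < r ∧ S.tr (S.mul (star x) x) = (r : ℂ) • S.empty s

/-- Irreducibility. -/
def IsIrreducible (_S : PlanarStarAlgebra V) : Prop :=
  ∀ s, Module.finrank ℂ (V 1 s) = 1

/-- The coproduct of two `2`-boxes: `a` stands on the left of `b`; the upper right string of `a` is
joined to the upper left string of `b`, and the lower right one to the lower left one. -/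
def coprod (S : PlanarStarAlgebra V) (a b : V 2 false) : V 2 false :=
  S.Z ⟨[⟨1, .cap⟩, ⟨0, .box 2 false a⟩, ⟨2, .box 2 false b⟩, ⟨1, .cup⟩],
    by simp [WellFormed, Piece.top, Piece.bot, Piece.Shaded]⟩

/-- The element `1 ⊡ a` of the `3`-boxes: one vertical string, and on its right the Fourier
transform (the clockwise rotation by one click) of the `2`-box `a`. -/
def oneBox (S : PlanarStarAlgebra V) (a : V 2 false) : V 3 false :=
  S.Z ⟨[⟨3, .cap⟩, ⟨2, .box 2 false a⟩, ⟨1, .cup⟩],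
    by simp [WellFormed, Piece.top, Piece.bot, Piece.Shaded]⟩

/-- Projections, that is self-adjoint idempotents, of the algebra of `n`-boxes. -/
def IsProjection (S : PlanarStarAlgebra V) {n : ℕ} {s : Bool} (p : V n s) : Prop :=
  S.mul p p = p ∧ star p = p

/-- `p` is the support of the self-adjoint element `x`: the smallest projection `p` with
`p x = x`. -/
def IsSupport (S : PlanarStarAlgebra V) {n : ℕ} {s : Bool} (x p : V n s) : Prop :=
  S.IsProjection p ∧ S.mul p x = x ∧
    ∀ q : V n s, S.IsProjection q → S.mul q x = x → S.mul q p = p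

/-- `x ⪯ y` for self-adjoint elements: the support of `x` is a subprojection of that of `y`. -/
def Weaker (S : PlanarStarAlgebra V) {n : ℕ} {s : Bool} (x y : V n s) : Prop :=
  star x = x ∧ star y = y ∧ ∃ p q : V n s, S.IsSupport x p ∧ S.IsSupport y q ∧ S.mul q p = p

/-- A biprojection: a projection `Q` in the `2`-boxes such that `1 ⊡ Q` is a multiple of
a projection of the form `1 ⊡ z`. -/
def IsBiprojection (S : PlanarStarAlgebra V) (Q : V 2 false) : Prop :=
  S.IsProjection Q ∧
    ∃ (c : ℂ) (z : V 2 false), S.IsProjection (S.oneBox z) ∧ S.oneBox Q = c • S.oneBox z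

end PlanarStarAlgebra

/-! ### Words of layers -/

namespace Layer

variable {V : ℕ → Bool → Type u}

abbrev cap (i : ℕ) : Layer V := ⟨i, .cap⟩

abbrev cup (i : ℕ) : Layer V := ⟨i, .cup⟩

abbrev box (i : ℕ) {m : ℕ} {t : Bool} (x : V m t) : Layer V := ⟨i, .box m t x⟩

/-- The word `w`, moved to the right by `i` strings. -/
def shift (i : ℕ) (w : List (Layer V)) : List (Layer V) :=
  w.map fun l => ⟨i + l.pos, l.piece⟩

/-- The boolean form of `Piece.Shaded`. -/
def shadedBool (r : Bool) : Piece V → Bool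
  | .cap => true
  | .cup => true
  | .box _ s _ => !(xor s r)

/-- The parity of a number, by recursion, so that it is computed by `rfl`. -/
def parity : ℕ → Bool
  | 0 => false
  | n + 1 => !parity n

theorem parity_eq_bodd (n : ℕ) : parity n = n.bodd := by
  induction n with
  | zero => rfl
  | succ n ih => rw [parity, ih, Nat.bodd_succ]

/-- The boolean form of `WellFormed`. -/
def wfBool (s : Bool) : ℕ → List (Layer V) → ℕ → Bool
  | k, [], m => Nat.beq k m
  | k, l :: w, m => Nat.ble (l.pos + l.piece.top) k && shadedBool (xor s (parity l.pos)) l.piece &&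
      wfBool s (k - l.piece.top + l.piece.bot) w m

theorem shaded_of_shadedBool {r : Bool} {p : Piece V} (h : shadedBool r p = true) : p.Shaded r := by
  cases p <;> simp_all [shadedBool, Piece.Shaded]

theorem wellFormed_of_wfBool {s : Bool} {w : List (Layer V)} {k m : ℕ}
    (h : wfBool s k w m = true) : WellFormed s k w m := by
  induction w generalizing k with
  | nil => exact Nat.eq_of_beq_eq_true h
  | cons l w ih =>
    simp only [wfBool, Bool.and_eq_true, parity_eq_bodd] at h
    exact ⟨Nat.le_of_ble_eq_true h.1.1, shaded_of_shadedBool h.1.2, ih h.2⟩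

theorem wfBool_nil (s : Bool) (n : ℕ) : wfBool (V := V) s n [] n = true := by
  simp [wfBool]

theorem wfBool_one_box {n : ℕ} {s : Bool} (a : V n s) : wfBool s n [box 0 a] n = true := by
  cases s <;> simp [wfBool, shadedBool, parity, Piece.top, Piece.bot]

theorem wfBool_two_boxes {n : ℕ} {s : Bool} (a b : V n s) :
    wfBool s n [box 0 a, box 0 b] n = true := by
  cases s <;> simp [wfBool, shadedBool, parity, Piece.top, Piece.bot]

theorem wellFormed_box_iff {s t : Bool} {m k n i : ℕ} (u v : List (Layer V)) (x y : V m t) :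
    WellFormed s k (u ++ box i x :: v) n ↔ WellFormed s k (u ++ box i y :: v) n := by
  induction u generalizing k with
  | nil => exact Iff.rfl
  | cons l u ih => exact and_congr_right fun _ => and_congr_right fun _ => ih

/-- Exchange the layers `n` and `n + 1`, when the second one lies to the right. -/
def exchange : ℕ → List (Layer V) → List (Layer V)
  | 0, a :: b :: w =>
      if a.pos + a.piece.bot ≤ b.pos then
        ⟨b.pos - a.piece.bot + a.piece.top, b.piece⟩ :: a :: w
      else a :: b :: w
  | n + 1, a :: w => a :: exchange n w
  | _, w => w

/-- Exchange the layers `n` and `n + 1`, when the second one lies to the left. -/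
def exchangeRev : ℕ → List (Layer V) → List (Layer V)
  | 0, a :: b :: w =>
      if b.pos + b.piece.top ≤ a.pos then
        b :: ⟨a.pos - b.piece.top + b.piece.bot, a.piece⟩ :: w
      else a :: b :: w
  | n + 1, a :: w => a :: exchangeRev n w
  | _, w => w

/-- Straighten the zigzag formed by the layers `n` and `n + 1`. -/
def straighten : ℕ → List (Layer V) → List (Layer V)
  | 0, ⟨i, .cap⟩ :: ⟨j, .cup⟩ :: w =>
      if i = j + 1 ∨ j = i + 1 then w else ⟨i, .cap⟩ :: ⟨j, .cup⟩ :: w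
  | n + 1, a :: w => a :: straighten n w
  | _, w => w

end Layer

theorem Move.cons {V : ℕ → Bool → Type u} {w w' : List (Layer V)} (a : Layer V) (h : Move w w') :
    Move (a :: w) (a :: w') := by
  cases h with
  | exchange u v i d A B => exact Move.exchange (a :: u) v i d A B
  | zigzag_left u v i => exact Move.zigzag_left (a :: u) v i
  | zigzag_right u v i => exact Move.zigzag_right (a :: u) v i
  | turn u v i n s x => exact Move.turn (a :: u) v i n s x

namespace Layer

variable {V : ℕ → Bool → Type u}

theorem move_exchange (n : ℕ) (w : List (Layer V)) : exchange n w = w ∨ Move w (exchange n w) := by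
  induction n, w using exchange.induct with
  | case1 a b w h =>
    right
    have := Move.exchange [] w a.pos (b.pos - (a.pos + a.piece.bot)) a.piece b.piece
    simp only [exchange, if_pos h]
    rwa [Nat.add_sub_of_le h, show a.pos + a.piece.top + (b.pos - (a.pos + a.piece.bot)) =
      b.pos - a.piece.bot + a.piece.top by omega] at this
  | case2 a b w h => left; simp [exchange, h]
  | case3 n a w ih => exact ih.imp (fun h => by simp [exchange, h]) (fun h => h.cons a)
  | case4 => left; rw [exchange] <;> assumption

theorem move_exchangeRev (n : ℕ) (w : List (Layer V)) :
    exchangeRev n w = w ∨ Move (exchangeRev n w) w := by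
  induction n, w using exchangeRev.induct with
  | case1 a b w h =>
    right
    have := Move.exchange [] w b.pos (a.pos - (b.pos + b.piece.top)) b.piece a.piece
    simp only [exchangeRev, if_pos h]
    rwa [Nat.add_sub_of_le h, show b.pos + b.piece.bot + (a.pos - (b.pos + b.piece.top)) =
      a.pos - b.piece.top + b.piece.bot by omega] at this
  | case2 a b w h => left; simp [exchangeRev, h]
  | case3 n a w ih => exact ih.imp (fun h => by simp [exchangeRev, h]) (fun h => h.cons a)
  | case4 => left; rw [exchangeRev] <;> assumption

theorem move_straighten (n : ℕ) (w : List (Layer V)) :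
    straighten n w = w ∨ Move w (straighten n w) := by
  induction n, w using straighten.induct with
  | case1 i j w h =>
    right
    simp only [straighten, if_pos h]
    rcases h with rfl | rfl
    · exact Move.zigzag_left [] w j
    · exact Move.zigzag_right [] w i
  | case2 i j w h => left; simp [straighten, h]
  | case3 n a w ih => exact ih.imp (fun h => by simp [straighten, h]) (fun h => h.cons a)
  | case4 => left; rw [straighten] <;> assumption

theorem shaded_congr {p : Piece V} {r r' : Bool} (h : r = r') (hp : p.Shaded r) : p.Shaded r' :=
  h ▸ hp

theorem bodd_bot (p : Piece V) : p.bot.bodd = p.top.bodd := by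
  cases p <;> simp [Piece.top, Piece.bot]

theorem bodd_sub {a b : ℕ} (h : b ≤ a) : (a - b).bodd = xor a.bodd b.bodd := by
  obtain ⟨c, rfl⟩ := Nat.exists_eq_add_of_le h
  simp [Nat.bodd_add]
  cases b.bodd <;> cases c.bodd <;> rfl

theorem wellFormed_exchange {s : Bool} {k m : ℕ} (n : ℕ) (w : List (Layer V))
    (h : WellFormed s k w m) : WellFormed s k (exchange n w) m := by
  induction n, w using exchange.induct generalizing k with
  | case1 a b w hab =>
    obtain ⟨h1, h2, h3, h4, h5⟩ := h
    simp only [exchange, if_pos hab]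
    refine ⟨by simp only; omega, shaded_congr ?_ h4, by simp only; omega, h2, ?_⟩
    · simp only [Nat.bodd_add, bodd_sub (show a.piece.bot ≤ b.pos by omega), bodd_bot]
      cases b.pos.bodd <;> cases a.piece.top.bodd <;> rfl
    · convert h5 using 1; simp only; omega
  | case2 a b w hab => simpa [exchange, hab] using h
  | case3 n a w ih => exact ⟨h.1, h.2.1, ih h.2.2⟩
  | case4 => rw [exchange] <;> assumption

theorem wellFormed_exchangeRev {s : Bool} {k m : ℕ} (n : ℕ) (w : List (Layer V))
    (h : WellFormed s k w m) : WellFormed s k (exchangeRev n w) m := by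
  induction n, w using exchangeRev.induct generalizing k with
  | case1 a b w hab =>
    obtain ⟨h1, h2, h3, h4, h5⟩ := h
    simp only [exchangeRev, if_pos hab]
    refine ⟨by omega, h4, by simp only; omega, shaded_congr ?_ h2, ?_⟩
    · simp only [Nat.bodd_add, bodd_sub (show b.piece.top ≤ a.pos by omega), bodd_bot]
      cases a.pos.bodd <;> cases b.piece.top.bodd <;> rfl
    · convert h5 using 1; simp only; omega
  | case2 a b w hab => simpa [exchangeRev, hab] using h
  | case3 n a w ih => exact ⟨h.1, h.2.1, ih h.2.2⟩
  | case4 => rw [exchangeRev] <;> assumption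

theorem wellFormed_straighten {s : Bool} {k m : ℕ} (n : ℕ) (w : List (Layer V))
    (h : WellFormed s k w m) : WellFormed s k (straighten n w) m := by
  induction n, w using straighten.induct generalizing k with
  | case1 i j w hij =>
    obtain ⟨h1, h2, h3, h4, h5⟩ := h
    simp only [straighten, if_pos hij]
    exact h5
  | case2 i j w hij => simpa [straighten, hij] using h
  | case3 n a w ih => exact ⟨h.1, h.2.1, ih h.2.2⟩
  | case4 => rw [straighten] <;> assumption

/-- The steps of an isotopy. -/
inductive Step
  | ex (n : ℕ)
  | exr (n : ℕ)
  | zig (n : ℕ)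

def Step.apply : Step → List (Layer V) → List (Layer V)
  | .ex n => exchange n
  | .exr n => exchangeRev n
  | .zig n => straighten n

def run : List Step → List (Layer V) → List (Layer V)
  | [], w => w
  | a :: l, w => run l (a.apply w)

end Layer

namespace PlanarStarAlgebra

open Layer

variable {V : ℕ → Bool → Type u} [∀ n s, AddCommGroup (V n s)] [∀ n s, Module ℂ (V n s)]
  [∀ n s, StarAddMonoid (V n s)] (S : PlanarStarAlgebra V)

open Classical in
/-- The value of a word, which is zero unless the word is that of a tangle. -/
noncomputable def ev (n : ℕ) (s : Bool) (w : List (Layer V)) : V n s :=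
  if h : WellFormed s n w n then S.Z ⟨w, h⟩ else 0

variable {n m : ℕ} {s t : Bool}

theorem ev_of_wf {w : List (Layer V)} (h : WellFormed s n w n) : S.ev n s w = S.Z ⟨w, h⟩ :=
  dif_pos h

theorem Z_eq_ev (T : Tangle V n s) : S.Z T = S.ev n s T.word := (S.ev_of_wf T.wf).symm

theorem ev_apply (a : Step) {w : List (Layer V)} (h : WellFormed s n w n) :
    WellFormed s n (a.apply w) n ∧ S.ev n s (a.apply w) = S.ev n s w := by
  cases a with
  | ex i =>
    have h' := wellFormed_exchange i w h
    refine ⟨h', ?_⟩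
    rcases move_exchange i w with e | e
    · exact congrArg _ e
    · exact (S.ev_of_wf h').trans ((S.isotopy ⟨w, h⟩ ⟨_, h'⟩ e).symm.trans (S.ev_of_wf h).symm)
  | exr i =>
    have h' := wellFormed_exchangeRev i w h
    refine ⟨h', ?_⟩
    rcases move_exchangeRev i w with e | e
    · exact congrArg _ e
    · exact (S.ev_of_wf h').trans ((S.isotopy ⟨_, h'⟩ ⟨w, h⟩ e).trans (S.ev_of_wf h).symm)
  | zig i =>
    have h' := wellFormed_straighten i w h
    refine ⟨h', ?_⟩
    rcases move_straighten i w with e | e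
    · exact congrArg _ e
    · exact (S.ev_of_wf h').trans ((S.isotopy ⟨w, h⟩ ⟨_, h'⟩ e).symm.trans (S.ev_of_wf h).symm)

theorem ev_run (l : List Step) {w : List (Layer V)} (h : WellFormed s n w n) :
    S.ev n s (run l w) = S.ev n s w := by
  induction l generalizing w with
  | nil => rfl
  | cons a l ih => exact (ih (S.ev_apply a h).1).trans (S.ev_apply a h).2

/-- Two words that isotopies lead to the same word have the same value. -/
theorem ev_isotopic (l l' : List Step) {w w' : List (Layer V)} (h : wfBool s n w n = true)
    (h' : wfBool s n w' n = true) (e : run l w = run l' w') : S.ev n s w = S.ev n s w' := by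
  rw [← S.ev_run l (wellFormed_of_wfBool h), e, S.ev_run l' (wellFormed_of_wfBool h')]

theorem ev_box (x : V n s) : S.ev n s [box 0 x] = x := by
  have h : WellFormed s n [box 0 x] n := by
    simp [WellFormed, Piece.top, Piece.bot, Piece.Shaded]
  rw [S.ev_of_wf h]
  exact S.unit _ x rfl

/-- The gluing of the word `r` into a box. -/
theorem ev_glue (u v : List (Layer V)) (i : ℕ) (r : List (Layer V)) (hr : wfBool t m r m = true)
    (h : wfBool s n (u ++ box i (S.ev m t r) :: v) n = true)
    (h' : wfBool s n (u ++ (shift i r ++ v)) n = true) :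
    S.ev n s (u ++ box i (S.ev m t r) :: v) = S.ev n s (u ++ (shift i r ++ v)) := by
  rw [S.ev_of_wf (wellFormed_of_wfBool h), S.ev_of_wf (wellFormed_of_wfBool h')]
  refine S.gluing _ _ ⟨r, wellFormed_of_wfBool hr⟩ u v i ?_ ?_
  · simp [S.ev_of_wf (wellFormed_of_wfBool hr)]
  · simp [shift]

/-- The value of a word as a function of the label of one box. -/
noncomputable def boxMap (n : ℕ) (s : Bool) (u v : List (Layer V)) (i m : ℕ) (t : Bool) :
    V m t →ₗ[ℂ] V n s where
  toFun x := S.ev n s (u ++ box i x :: v)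
  map_add' x y := by
    by_cases h : WellFormed s n (u ++ box i (x + y) :: v) n
    · have h₁ := (wellFormed_box_iff u v (x + y) x).1 h
      have h₂ := (wellFormed_box_iff u v (x + y) y).1 h
      rw [S.ev_of_wf h, S.ev_of_wf h₁, S.ev_of_wf h₂]
      exact S.map_add _ _ _ u v i m t x y (by simp) (by simp) (by simp)
    · rw [ev, ev, ev, dif_neg h, dif_neg (mt (wellFormed_box_iff u v (x + y) x).2 h),
        dif_neg (mt (wellFormed_box_iff u v (x + y) y).2 h), add_zero]
  map_smul' c x := by
    by_cases h : WellFormed s n (u ++ box i (c • x) :: v) n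
    · have h₁ := (wellFormed_box_iff u v (c • x) x).1 h
      rw [S.ev_of_wf h, S.ev_of_wf h₁]
      exact S.map_smul _ _ u v i m t c x (by simp) (by simp)
    · rw [ev, ev, dif_neg h, dif_neg (mt (wellFormed_box_iff u v (c • x) x).2 h), smul_zero]

theorem boxMap_apply (u v : List (Layer V)) (i : ℕ) (x : V m t) :
    S.boxMap n s u v i m t x = S.ev n s (u ++ box i x :: v) := rfl

/-- The adjoint of the value of a word. -/
theorem star_ev {w : List (Layer V)} (h : wfBool s n w n = true)
    (h' : wfBool s n (w.reverse.map fun l => ⟨l.pos, l.piece.reflect⟩) n = true) :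
    star (S.ev n s w) = S.ev n s (w.reverse.map fun l => ⟨l.pos, l.piece.reflect⟩) := by
  rw [S.ev_of_wf (wellFormed_of_wfBool h), S.ev_of_wf (wellFormed_of_wfBool h')]
  exact (S.reflection _ _ rfl).symm

/-- If the word `r` has the value `c • id`, it can be removed at the cost of the factor `c`. -/
theorem ev_remove (u v : List (Layer V)) (i : ℕ) (r : List (Layer V)) (c : ℂ)
    (hc : S.ev m t r = c • S.ev m t []) (hr : wfBool t m r m = true)
    (h₀ : wfBool t m ([] : List (Layer V)) m = true)
    (h : wfBool s n (u ++ box i (S.ev m t r) :: v) n = true)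
    (h₁ : wfBool s n (u ++ box i (S.ev m t []) :: v) n = true)
    (h' : wfBool s n (u ++ (shift i r ++ v)) n = true) (h'' : wfBool s n (u ++ v) n = true) :
    S.ev n s (u ++ (shift i r ++ v)) = c • S.ev n s (u ++ v) := by
  rw [← S.ev_glue u v i r hr h h', hc, ← boxMap_apply, _root_.map_smul, boxMap_apply,
    S.ev_glue u v i [] h₀ h₁ h'']
  rfl

end PlanarStarAlgebra

namespace PlanarStarAlgebra

open Layer

variable {V : ℕ → Bool → Type u} [∀ n s, AddCommGroup (V n s)] [∀ n s, Module ℂ (V n s)]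
  [∀ n s, StarAddMonoid (V n s)] (S : PlanarStarAlgebra V) {n : ℕ} {s : Bool}

/-! ### The algebras of `n`-boxes -/

theorem mul_eq_ev (a b : V n s) : S.mul a b = S.ev n s [box 0 a, box 0 b] := S.Z_eq_ev _

theorem mul_sub (a b c : V n s) : S.mul a (b - c) = S.mul a b - S.mul a c := by
  simp only [mul_eq_ev]
  exact map_sub (S.boxMap n s [box 0 a] [] 0 n s) b c

theorem sub_mul (a b c : V n s) : S.mul (a - b) c = S.mul a c - S.mul b c := by
  simp only [mul_eq_ev]
  exact map_sub (S.boxMap n s [] [box 0 c] 0 n s) a b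

theorem mul_smul (r : ℂ) (a b : V n s) : S.mul a (r • b) = r • S.mul a b := by
  simp only [mul_eq_ev]
  exact _root_.map_smul (S.boxMap n s [box 0 a] [] 0 n s) r b

theorem smul_mul (r : ℂ) (a b : V n s) : S.mul (r • a) b = r • S.mul a b := by
  simp only [mul_eq_ev]
  exact _root_.map_smul (S.boxMap n s [] [box 0 b] 0 n s) r a

theorem mul_zero (a : V n s) : S.mul a 0 = 0 := by
  simpa using S.mul_smul 0 a 0

theorem zero_mul (a : V n s) : S.mul 0 a = 0 := by
  simpa using S.smul_mul 0 0 a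

theorem star_mul (a b : V n s) : star (S.mul a b) = S.mul (star b) (star a) :=
  (S.reflection _ _ rfl).symm

/-- The identity of the algebra of `n`-boxes. -/
noncomputable def one (n : ℕ) (s : Bool) : V n s := S.ev n s []

theorem star_one (n : ℕ) (s : Bool) : star (S.one n s) = S.one n s :=
  S.star_ev (wfBool_nil s n) (wfBool_nil s n)

theorem one_mul (a : V n s) : S.mul (S.one n s) a = a := by
  rw [mul_eq_ev]
  exact (S.ev_glue [] [box 0 a] 0 [] (wfBool_nil s n) (wfBool_two_boxes _ a)
    (wfBool_one_box a)).trans (S.ev_box a)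

theorem mul_one (a : V n s) : S.mul a (S.one n s) = a := by
  rw [mul_eq_ev]
  exact (S.ev_glue [box 0 a] [] 0 [] (wfBool_nil s n) (wfBool_two_boxes a _)
    (wfBool_one_box a)).trans (S.ev_box a)

theorem mul_assoc (a b c : V 2 false) : S.mul (S.mul a b) c = S.mul a (S.mul b c) := by
  rw [mul_eq_ev, mul_eq_ev, mul_eq_ev, mul_eq_ev]
  exact (S.ev_glue (m := 2) (t := false) [] [box 0 c] 0 [box 0 a, box 0 b] rfl rfl rfl).trans
    (S.ev_glue (m := 2) (t := false) [box 0 a] [] 0 [box 0 b, box 0 c] rfl rfl rfl).symm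

/-! ### Traces -/

theorem tr_eq_ev (a : V n s) : S.tr a = S.ev 0 s ((List.range n).map (fun j => cap j) ++
    ([box 0 a] ++ (List.range n).reverse.map (fun j => cup j))) := S.Z_eq_ev _

theorem tr_smul (c : ℂ) (a : V n s) : S.tr (c • a) = c • S.tr a := by
  simp only [tr_eq_ev]
  exact _root_.map_smul (S.boxMap 0 s _ _ 0 n s) c a

theorem tr_sub (a b : V n s) : S.tr (a - b) = S.tr a - S.tr b := by
  simp only [tr_eq_ev]
  exact map_sub (S.boxMap 0 s _ _ 0 n s) a b

variable {S}

theorem empty_ne_zero (hS : S.IsSubfactor) (s : Bool) : S.empty s ≠ 0 := by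
  have : Nontrivial (V 0 s) := Module.nontrivial_of_finrank_pos (R := ℂ)
    (by rw [hS.dim_zero s]; simp)
  obtain ⟨x, hx⟩ := exists_ne (0 : V 0 s)
  intro h
  apply hx
  rw [← S.one_mul x, one, ← S.Z_eq_ev ⟨[], rfl⟩]
  exact (congrArg (S.mul · x) h).trans (S.zero_mul x)

theorem eq_zero_of_tr_star_mul_self (hS : S.IsSubfactor) {x : V n s}
    (h : S.tr (S.mul (star x) x) = 0) : x = 0 := by
  by_contra hx
  obtain ⟨r, hr, e⟩ := hS.pos_def n s x hx
  rw [h, eq_comm, smul_eq_zero] at e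
  exact e.elim (by exact_mod_cast hr.ne') (empty_ne_zero hS s)

theorem one_ne_zero (hirr : S.IsIrreducible) (s : Bool) : S.one 1 s ≠ 0 := by
  have : Nontrivial (V 1 s) := Module.nontrivial_of_finrank_pos (R := ℂ) (by rw [hirr s]; simp)
  obtain ⟨x, hx⟩ := exists_ne (0 : V 1 s)
  intro h
  apply hx
  rw [← S.one_mul x, h, S.zero_mul]

theorem exists_eq_smul_one (hirr : S.IsIrreducible) (x : V 1 s) : ∃ c : ℂ, x = c • S.one 1 s := by
  obtain ⟨c, hc⟩ := (finrank_eq_one_iff_of_nonzero' _ (one_ne_zero hirr s)).1 (hirr s) x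
  exact ⟨c, hc.symm⟩

theorem tr_one_one (s : Bool) : S.tr (S.one 1 s) = S.ev 0 s [cap 0, cup 0] := by
  rw [tr_eq_ev]
  cases s <;> exact S.ev_glue [cap 0] [cup 0] 0 [] rfl rfl rfl

theorem leftTr_one (s : Bool) : S.leftTr (S.one 1 s) = S.ev 0 (!s) [cap 0, cup 0] := by
  rw [leftTr, Z_eq_ev]
  cases s <;> exact S.ev_glue [cap 0] [cup 0] 1 [] rfl rfl rfl

/-- The value of a closed string does not depend on the shading. -/
theorem exists_loop (hS : S.IsSubfactor) (hirr : S.IsIrreducible) :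
    ∃ d : ℂ, d ≠ 0 ∧ ∀ s, S.ev 0 s [cap 0, cup 0] = d • S.ev 0 s [] := by
  obtain ⟨r, hr, e⟩ := hS.pos_def 1 false _ (one_ne_zero hirr false)
  rw [star_one, one_mul] at e
  have e' := (hS.spherical _ _ _).1 e
  rw [tr_one_one, empty, Z_eq_ev] at e
  rw [leftTr_one, empty, Z_eq_ev] at e'
  refine ⟨r, by exact_mod_cast hr.ne', ?_⟩
  rintro (_ | _)
  exacts [e, e']

variable (S) in
/-- The right partial trace. -/
noncomputable def partialTr (a : V 2 false) : V 1 false := S.ev 1 false [cap 1, box 0 a, cup 1]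

variable (S) in
/-- The left partial trace. -/
noncomputable def leftPartialTr (a : V 2 false) : V 1 true := S.ev 1 true [cap 0, box 1 a, cup 0]

theorem tr_partialTr (a : V 2 false) : S.tr (S.partialTr a) = S.tr a := by
  rw [tr_eq_ev, tr_eq_ev]
  exact S.ev_glue [cap 0] [cup 0] 0 [cap 1, box 0 a, cup 1] rfl rfl rfl

theorem leftTr_partialTr (a : V 2 false) : S.leftTr (S.partialTr a) = S.tr (S.leftPartialTr a) := by
  rw [tr_eq_ev, leftTr, Z_eq_ev]
  refine (S.ev_glue [cap 0] [cup 0] 1 [cap 1, box 0 a, cup 1] rfl rfl rfl).trans ?_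
  refine Eq.trans ?_ (S.ev_glue [cap 0] [cup 0] 0 [cap 0, box 1 a, cup 0] rfl rfl rfl).symm
  exact S.ev_isotopic [] [.exr 0, .ex 3] rfl rfl rfl

/-- The two partial traces of a `2`-box are the same scalar. -/
theorem exists_partialTr (hS : S.IsSubfactor) (hirr : S.IsIrreducible) (a : V 2 false) :
    ∃ c : ℂ, S.partialTr a = c • S.one 1 false ∧ S.leftPartialTr a = c • S.one 1 true := by
  obtain ⟨d, hd, hl⟩ := exists_loop hS hirr
  obtain ⟨c, hc⟩ := exists_eq_smul_one hirr (S.partialTr a)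
  obtain ⟨c', hc'⟩ := exists_eq_smul_one hirr (S.leftPartialTr a)
  have h1 : S.tr (S.partialTr a) = (c * d) • S.empty false := by
    rw [hc, tr_smul, tr_one_one, hl, smul_smul, empty, Z_eq_ev]
  have h2 : S.leftTr (S.partialTr a) = (c' * d) • S.empty true := by
    rw [leftTr_partialTr, hc', tr_smul, tr_one_one, hl, smul_smul, empty, Z_eq_ev]
  have h3 := (hS.spherical _ _ _).1 h1
  have h4 : (c * d) • S.empty true = (c' * d) • S.empty true := h3.symm.trans h2
  have h5 := smul_left_injective ℂ (empty_ne_zero hS true) h4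
  exact ⟨c, hc, by rw [hc', mul_right_cancel₀ hd h5]⟩

/-! ### The coproduct -/

theorem coprod_eq_ev (a b : V 2 false) :
    S.coprod a b = S.ev 2 false [cap 1, box 0 a, box 2 b, cup 1] := S.Z_eq_ev _

theorem coprod_sub (a b c : V 2 false) :
    S.coprod a (b - c) = S.coprod a b - S.coprod a c := by
  simp only [coprod_eq_ev]
  exact map_sub (S.boxMap 2 false [cap 1, box 0 a] [cup 1] 2 2 false) b c

theorem sub_coprod (a b c : V 2 false) :
    S.coprod (a - b) c = S.coprod a c - S.coprod b c := by
  simp only [coprod_eq_ev]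
  exact map_sub (S.boxMap 2 false [cap 1] [box 2 c, cup 1] 0 2 false) a b

theorem star_coprod (a b : V 2 false) : star (S.coprod a b) = S.coprod (star a) (star b) := by
  rw [coprod_eq_ev, coprod_eq_ev, S.star_ev rfl rfl]
  exact S.ev_isotopic [] [.ex 1] rfl rfl rfl

theorem one_coprod {a : V 2 false} {c : ℂ} (h : S.leftPartialTr a = c • S.one 1 true) :
    S.coprod (S.one 2 false) a = c • S.one 2 false := by
  rw [coprod_eq_ev]
  refine (S.ev_glue [cap 1] [box 2 a, cup 1] 0 [] rfl rfl rfl).trans ?_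
  exact S.ev_remove [] [] 1 [cap 0, box 1 a, cup 0] c h rfl rfl rfl rfl rfl rfl

theorem coprod_one {a : V 2 false} {c : ℂ} (h : S.partialTr a = c • S.one 1 false) :
    S.coprod a (S.one 2 false) = c • S.one 2 false := by
  rw [coprod_eq_ev]
  refine (S.ev_glue [cap 1, box 0 a] [cup 1] 2 [] rfl rfl rfl).trans ?_
  exact S.ev_remove [] [] 0 [cap 1, box 0 a, cup 1] c h rfl rfl rfl rfl rfl rfl

theorem tr_coprod {a b : V 2 false} {c : ℂ} (h : S.partialTr b = c • S.one 1 false) :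
    S.tr (S.coprod a b) = c • S.tr a := by
  rw [tr_eq_ev, tr_eq_ev, coprod_eq_ev]
  refine (S.ev_glue [cap 0, cap 1] [cup 1, cup 0] 0 [cap 1, box 0 a, box 2 b, cup 1]
    rfl rfl rfl).trans ?_
  refine (S.ev_isotopic (w' := [cap 0, cap 1, box 0 a, cap 3, box 2 b, cup 3, cup 1, cup 0])
    [] [.ex 2, .ex 1, .exr 5] rfl rfl rfl).trans ?_
  exact S.ev_remove [cap 0, cap 1, box 0 a] [cup 1, cup 0] 2 [cap 1, box 0 b, cup 1] c h
    rfl rfl rfl rfl rfl rfl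

/-! ### Positivity of the coproduct -/

variable (S) in
/-- The `4`-box whose square is the pairing of `a * b` with `c`. -/
noncomputable def vertex (a b c : V 2 false) : V 4 false :=
  S.ev 4 false [box 0 a, box 2 b, cup 1, box 0 c, cap 1]

theorem tr_cup_box_cap {d : ℂ} (hd : ∀ s, S.ev 0 s [cap 0, cup 0] = d • S.ev 0 s [])
    (y : V 2 false) : S.tr (S.ev 4 false [cup 1, box 0 y, cap 1]) = d • S.tr y := by
  rw [tr_eq_ev, tr_eq_ev]
  refine (S.ev_glue [cap 0, cap 1, cap 2, cap 3] [cup 3, cup 2, cup 1, cup 0] 0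
    [cup 1, box 0 y, cap 1] rfl rfl rfl).trans ?_
  refine (S.ev_isotopic (w' := [cap 0, cap 1, box 0 y, cup 1, cap 1, cup 1, cup 0])
    [.exr 3, .zig 2, .ex 4, .zig 5] [.ex 3, .ex 2, .ex 1] rfl rfl rfl).trans ?_
  exact S.ev_remove [cap 0, cap 1, box 0 y, cup 1] [cup 0] 1 [cap 0, cup 0] d (hd true)
    rfl rfl rfl rfl rfl rfl

theorem star_vertex_mul_vertex {a b c : V 2 false} (ha : S.IsProjection a) (hb : S.IsProjection b)
    (hc : S.IsProjection c) : S.mul (star (S.vertex a b c)) (S.vertex a b c) =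
      S.ev 4 false [cup 1, box 0 (S.mul c (S.mul (S.coprod a b) c)), cap 1] := by
  have h1 : star (S.vertex a b c) = S.ev 4 false [cup 1, box 0 c, cap 1, box 2 b, box 0 a] := by
    rw [vertex, S.star_ev rfl rfl]
    simp [Piece.reflect, ha.2, hb.2, hc.2]
  rw [mul_eq_ev, h1, vertex]
  refine (S.ev_glue [] [box 0 (S.ev 4 false [box 0 a, box 2 b, cup 1, box 0 c, cap 1])] 0
    [cup 1, box 0 c, cap 1, box 2 b, box 0 a] rfl rfl rfl).trans ?_
  refine (S.ev_glue [cup 1, box 0 c, cap 1, box 2 b, box 0 a] [] 0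
    [box 0 a, box 2 b, cup 1, box 0 c, cap 1] rfl rfl rfl).trans ?_
  refine (S.ev_isotopic (w' := [cup 1, box 0 c, cap 1, box 0 a, box 0 a, box 2 b, box 2 b,
    cup 1, box 0 c, cap 1]) [] [.ex 4, .ex 3] rfl rfl rfl).trans ?_
  refine (S.ev_glue (m := 2) (t := false) [cup 1, box 0 c, cap 1]
    [box 2 b, box 2 b, cup 1, box 0 c, cap 1] 0 [box 0 a, box 0 a] rfl rfl rfl).symm.trans ?_
  rw [← mul_eq_ev, ha.1]
  refine (S.ev_glue (m := 2) (t := false) [cup 1, box 0 c, cap 1, box 0 a] [cup 1, box 0 c, cap 1] 2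
    [box 0 b, box 0 b] rfl rfl rfl).symm.trans ?_
  rw [← mul_eq_ev, hb.1]
  refine (S.ev_glue (m := 2) (t := false) [cup 1, box 0 c] [box 0 c, cap 1] 0
    [cap 1, box 0 a, box 2 b, cup 1] rfl rfl rfl).symm.trans ?_
  rw [← coprod_eq_ev]
  refine (S.ev_glue (m := 2) (t := false) [cup 1, box 0 c] [cap 1] 0
    [box 0 (S.coprod a b), box 0 c] rfl rfl rfl).symm.trans ?_
  rw [← mul_eq_ev]
  refine (S.ev_glue (m := 2) (t := false) [cup 1] [cap 1] 0
    [box 0 c, box 0 (S.mul (S.coprod a b) c)] rfl rfl rfl).symm.trans ?_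
  rw [← mul_eq_ev]
  rfl

theorem vertex_eq_zero (hS : S.IsSubfactor) (hirr : S.IsIrreducible) {a b c : V 2 false}
    (ha : S.IsProjection a) (hb : S.IsProjection b) (hc : S.IsProjection c)
    (h : S.tr (S.mul c (S.mul (S.coprod a b) c)) = 0) : S.vertex a b c = 0 := by
  obtain ⟨d, -, hl⟩ := exists_loop hS hirr
  apply eq_zero_of_tr_star_mul_self hS
  rw [star_vertex_mul_vertex ha hb hc, tr_cup_box_cap hl, h, smul_zero]

theorem coprod_mul_eq_zero (hS : S.IsSubfactor) (hirr : S.IsIrreducible) {a b c : V 2 false}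
    (h : S.vertex a b c = 0) : S.mul (S.coprod a b) c = 0 := by
  obtain ⟨d, hd, hl⟩ := exists_loop hS hirr
  have h1 : S.ev 2 false [cap 1, box 0 (S.vertex a b c), cup 1] = d • S.mul (S.coprod a b) c := by
    refine (S.ev_glue [cap 1] [cup 1] 0 [box 0 a, box 2 b, cup 1, box 0 c, cap 1]
      rfl rfl rfl).trans ?_
    refine (S.ev_remove [cap 1, box 0 a, box 2 b, cup 1, box 0 c] [] 1 [cap 0, cup 0] d (hl true)
      rfl rfl rfl rfl rfl rfl).trans ?_
    congr 1
    refine (S.ev_glue (m := 2) (t := false) [] [box 0 c] 0 [cap 1, box 0 a, box 2 b, cup 1]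
      rfl rfl rfl).symm.trans ?_
    rw [← coprod_eq_ev, mul_eq_ev]
    rfl
  have h2 : S.ev 2 false [cap 1, box 0 (S.vertex a b c), cup 1] = 0 := by
    rw [h]
    exact map_zero (S.boxMap 2 false [cap 1] [cup 1] 0 4 false)
  exact (smul_eq_zero.1 (h1.symm.trans h2)).resolve_left hd

/-! ### Rotations -/

theorem oneBox_eq_ev (a : V 2 false) :
    S.oneBox a = S.ev 3 false [cap 3, box 2 a, cup 1] := S.Z_eq_ev _

theorem oneBox_smul (c : ℂ) (a : V 2 false) : S.oneBox (c • a) = c • S.oneBox a := by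
  simp only [oneBox_eq_ev]
  exact _root_.map_smul (S.boxMap 3 false [cap 3] [cup 1] 2 2 false) c a

theorem oneBox_mul (a b : V 2 false) :
    S.mul (S.oneBox a) (S.oneBox b) = S.oneBox (S.coprod a b) := by
  rw [mul_eq_ev, oneBox_eq_ev, oneBox_eq_ev, oneBox_eq_ev, coprod_eq_ev]
  refine (S.ev_glue [] [box 0 (S.ev 3 false [cap 3, box 2 b, cup 1])] 0
    [cap 3, box 2 a, cup 1] rfl rfl rfl).trans ?_
  refine (S.ev_glue [cap 3, box 2 a, cup 1] [] 0 [cap 3, box 2 b, cup 1] rfl rfl rfl).trans ?_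
  refine Eq.trans ?_ (S.ev_glue [cap 3] [cup 1] 2
    [cap 1, box 0 a, box 2 b, cup 1] rfl rfl rfl).symm
  exact S.ev_isotopic [] [.exr 0, .exr 1, .exr 4, .exr 3, .exr 2] rfl rfl rfl

theorem oneBox_injective (hS : S.IsSubfactor) (hirr : S.IsIrreducible) {a b : V 2 false}
    (h : S.oneBox a = S.oneBox b) : a = b := by
  obtain ⟨d, hd, hl⟩ := exists_loop hS hirr
  have key (x : V 2 false) :
      S.ev 2 false [cap 0, cap 1, box 2 (S.oneBox x), cup 1, cup 2] = d • x := by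
    rw [oneBox_eq_ev]
    refine (S.ev_glue [cap 0, cap 1] [cup 1, cup 2] 2 [cap 3, box 2 x, cup 1] rfl rfl rfl).trans ?_
    refine (S.ev_isotopic (w' := [box 0 x, cap 1, cup 1])
      [.ex 5, .ex 4, .ex 3, .zig 2, .ex 1, .ex 0, .ex 2, .zig 1] [] rfl rfl rfl).trans ?_
    refine (S.ev_remove [box 0 x] [] 1 [cap 0, cup 0] d (hl true) rfl rfl rfl rfl rfl rfl).trans ?_
    exact congrArg _ (S.ev_box x)
  have := key a
  rw [h, key b] at this
  exact (smul_right_injective _ hd this).symm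

end PlanarStarAlgebra

namespace PlanarStarAlgebra

open Layer

variable {V : ℕ → Bool → Type u} [∀ n s, AddCommGroup (V n s)] [∀ n s, Module ℂ (V n s)]
  [∀ n s, StarAddMonoid (V n s)] {S : PlanarStarAlgebra V} {p : V 2 false}

/-! ### Projections that are closed under the coproduct -/

theorem IsProjection.one_sub (hp : S.IsProjection p) : S.IsProjection (S.one 2 false - p) := by
  constructor
  · rw [mul_sub, mul_one, sub_mul, one_mul, hp.1, sub_self, sub_zero]
  · rw [star_sub, star_one, hp.2]

theorem mul_coprod (hp : S.IsProjection p) (h : S.mul (S.coprod p p) p = S.coprod p p) :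
    S.mul p (S.coprod p p) = S.coprod p p := by
  have := congrArg star h
  rwa [star_mul, star_coprod, hp.2] at this

theorem tr_smul_sub_coprod {α : ℂ} (h₁ : S.partialTr p = α • S.one 1 false) :
    S.tr (α • p - S.coprod p p) = 0 := by
  rw [tr_sub, tr_coprod h₁, tr_smul, sub_self]

theorem mul_smul_one_sub_mul {α : ℂ} (hp : S.IsProjection p)
    (h : S.mul (S.coprod p p) p = S.coprod p p) :
    S.mul p (S.mul (α • S.one 2 false - S.coprod p p) p) = α • p - S.coprod p p := by
  rw [sub_mul, smul_mul, one_mul, h, mul_sub, mul_smul, hp.1, mul_coprod hp h]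

theorem vertex_one_sub_left {α : ℂ} (h₁ : S.partialTr p = α • S.one 1 false)
    (h₂ : S.leftPartialTr p = α • S.one 1 true)
    (hS : S.IsSubfactor) (hirr : S.IsIrreducible) (hp : S.IsProjection p)
    (h : S.mul (S.coprod p p) p = S.coprod p p) : S.vertex (S.one 2 false - p) p p = 0 := by
  apply vertex_eq_zero hS hirr hp.one_sub hp hp
  rw [sub_coprod, one_coprod h₂, mul_smul_one_sub_mul hp h, tr_smul_sub_coprod h₁]

theorem vertex_one_sub_right {α : ℂ} (h₁ : S.partialTr p = α • S.one 1 false)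
    (hS : S.IsSubfactor) (hirr : S.IsIrreducible) (hp : S.IsProjection p)
    (h : S.mul (S.coprod p p) p = S.coprod p p) : S.vertex p (S.one 2 false - p) p = 0 := by
  apply vertex_eq_zero hS hirr hp hp.one_sub hp
  rw [coprod_sub, coprod_one h₁, mul_smul_one_sub_mul hp h, tr_smul_sub_coprod h₁]

theorem coprod_self_eq_smul {α : ℂ} (h₁ : S.partialTr p = α • S.one 1 false)
    (h₂ : S.leftPartialTr p = α • S.one 1 true)
    (hS : S.IsSubfactor) (hirr : S.IsIrreducible) (hp : S.IsProjection p)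
    (h : S.mul (S.coprod p p) p = S.coprod p p) : S.coprod p p = α • p := by
  have := coprod_mul_eq_zero hS hirr (vertex_one_sub_left h₁ h₂ hS hirr hp h)
  rw [sub_coprod, one_coprod h₂, sub_mul, smul_mul, one_mul, h] at this
  exact (sub_eq_zero.1 this).symm

/-- The exchange relation of a projection that is closed under the coproduct. -/
theorem exchange_relation (hS : S.IsSubfactor) (hirr : S.IsIrreducible) (hp : S.IsProjection p)
    (h : S.mul (S.coprod p p) p = S.coprod p p) :
    S.ev 4 false [box 0 p, cup 1, box 0 p, cap 1] =
      S.ev 4 false [box 2 p, cup 1, box 0 p, cap 1] := by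
  obtain ⟨α, h₁, h₂⟩ := exists_partialTr hS hirr p
  have hl := vertex_one_sub_left h₁ h₂ hS hirr hp h
  have hr := vertex_one_sub_right h₁ hS hirr hp h
  have el : S.vertex (S.one 2 false - p) p p =
      S.vertex (S.one 2 false) p p - S.vertex p p p :=
    map_sub (S.boxMap 4 false [] [box 2 p, cup 1, box 0 p, cap 1] 0 2 false) _ _
  have er : S.vertex p (S.one 2 false - p) p =
      S.vertex p (S.one 2 false) p - S.vertex p p p :=
    map_sub (S.boxMap 4 false [box 0 p] [cup 1, box 0 p, cap 1] 2 2 false) _ _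
  rw [el, sub_eq_zero] at hl
  rw [er, sub_eq_zero] at hr
  have gl : S.vertex (S.one 2 false) p p = S.ev 4 false [box 2 p, cup 1, box 0 p, cap 1] :=
    S.ev_glue [] [box 2 p, cup 1, box 0 p, cap 1] 0 [] rfl rfl rfl
  have gr : S.vertex p (S.one 2 false) p = S.ev 4 false [box 0 p, cup 1, box 0 p, cap 1] :=
    S.ev_glue [box 0 p] [cup 1, box 0 p, cap 1] 2 [] rfl rfl rfl
  rw [← gl, ← gr, hl, hr]

variable (S) in
/-- A `2`-box whose upper points are joined, read as a `1`-box. -/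
noncomputable def cappedBox (a : V 2 false) : V 1 true := S.ev 1 true [cap 1, box 1 a, cup 0]

theorem star_cappedBox (a : V 2 false) :
    star (S.cappedBox a) = S.ev 1 true [cap 0, box 1 (star a), cup 1] :=
  S.star_ev rfl rfl

/-- A nonzero projection that is closed under the coproduct dominates the Jones projection. -/
theorem cappedBox_eq_one (hS : S.IsSubfactor) (hirr : S.IsIrreducible) (hp : S.IsProjection p)
    (h : S.mul (S.coprod p p) p = S.coprod p p) (h0 : p ≠ 0) : S.cappedBox p = S.one 1 true := by
  obtain ⟨d, hd, hl⟩ := exists_loop hS hirr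
  obtain ⟨c, hc⟩ := exists_eq_smul_one hirr (S.cappedBox p)
  have e : S.ev 2 false [cap 2, box 0 (S.ev 4 false [box 0 p, cup 1, box 0 p, cap 1]), cup 1] =
      S.ev 2 false [cap 2, box 0 (S.ev 4 false [box 2 p, cup 1, box 0 p, cap 1]), cup 1] := by
    rw [exchange_relation hS hirr hp h]
  have e1 : S.ev 2 false [cap 2, box 0 (S.ev 4 false [box 0 p, cup 1, box 0 p, cap 1]), cup 1] =
      d • p := by
    refine (S.ev_glue [cap 2] [cup 1] 0 [box 0 p, cup 1, box 0 p, cap 1] rfl rfl rfl).trans ?_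
    refine (S.ev_remove [cap 2, box 0 p, cup 1, box 0 p] [] 1 [cap 0, cup 0] d (hl true)
      rfl rfl rfl rfl rfl rfl).trans ?_
    refine congrArg _ ?_
    refine (S.ev_isotopic (w' := [box 0 p, box 0 p]) [.exr 0, .zig 1] [] rfl rfl rfl).trans ?_
    rw [← mul_eq_ev, hp.1]
  have e2 : S.ev 2 false [cap 2, box 0 (S.ev 4 false [box 2 p, cup 1, box 0 p, cap 1]), cup 1] =
      d • c • p := by
    refine (S.ev_glue [cap 2] [cup 1] 0 [box 2 p, cup 1, box 0 p, cap 1] rfl rfl rfl).trans ?_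
    refine (S.ev_remove [cap 2, box 2 p, cup 1, box 0 p] [] 1 [cap 0, cup 0] d (hl true)
      rfl rfl rfl rfl rfl rfl).trans ?_
    refine congrArg _ ?_
    refine (S.ev_remove [] [box 0 p] 1 [cap 1, box 1 p, cup 0] c hc rfl rfl rfl rfl rfl rfl).trans ?_
    exact congrArg _ (S.ev_box p)
  have e3 : (1 : ℂ) • p = c • p := by
    rw [one_smul]
    exact smul_right_injective _ hd (e1.symm.trans (e.trans e2))
  rw [hc, ← smul_left_injective ℂ h0 e3, one_smul]

/-- The rotation by a half turn fixes the projections that are closed under the coproduct. -/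
theorem halfTurn_eq_self (hS : S.IsSubfactor) (hirr : S.IsIrreducible) (hp : S.IsProjection p)
    (h : S.mul (S.coprod p p) p = S.coprod p p) (h0 : p ≠ 0) :
    S.ev 2 false [cap 0, cap 1, box 2 p, cup 3, cup 2] = p := by
  obtain ⟨d, hd, hl⟩ := exists_loop hS hirr
  have hc : S.ev 1 true [cap 0, box 1 p, cup 1] = (1 : ℂ) • S.ev 1 true [] := by
    have := star_cappedBox (S := S) p
    rw [cappedBox_eq_one hS hirr hp h h0, star_one, hp.2] at this
    rw [one_smul, ← this, one]
  have e : S.ev 2 false [cap 0, cap 1,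
        box 2 (S.ev 4 false [box 0 p, cup 1, box 0 p, cap 1]), cup 3, cup 2] =
      S.ev 2 false [cap 0, cap 1,
        box 2 (S.ev 4 false [box 2 p, cup 1, box 0 p, cap 1]), cup 3, cup 2] := by
    rw [exchange_relation hS hirr hp h]
  have e1 : S.ev 2 false [cap 0, cap 1,
        box 2 (S.ev 4 false [box 0 p, cup 1, box 0 p, cap 1]), cup 3, cup 2] =
      d • S.ev 2 false [cap 0, cap 1, box 2 p, cup 3, cup 2] := by
    refine (S.ev_glue [cap 0, cap 1] [cup 3, cup 2] 2 [box 0 p, cup 1, box 0 p, cap 1]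
      rfl rfl rfl).trans ?_
    refine (S.ev_remove [cap 0, cap 1, box 2 p, cup 3, box 2 p] [cup 2] 3 [cap 0, cup 0] d
      (hl true) rfl rfl rfl rfl rfl rfl).trans ?_
    refine congrArg _ ?_
    refine (S.ev_isotopic
      (w' := [cap 0, cap 1, box 2 p, cup 3, cap 3, box 4 p, cup 4, cup 2])
      [] [.exr 6, .exr 5, .zig 4] rfl rfl rfl).trans ?_
    exact (S.ev_remove [cap 0, cap 1, box 2 p, cup 3] [cup 2] 3 [cap 0, box 1 p, cup 1] 1
      hc rfl rfl rfl rfl rfl rfl).trans (one_smul _ _)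
  have e2 : S.ev 2 false [cap 0, cap 1,
        box 2 (S.ev 4 false [box 2 p, cup 1, box 0 p, cap 1]), cup 3, cup 2] = d • p := by
    refine (S.ev_glue [cap 0, cap 1] [cup 3, cup 2] 2 [box 2 p, cup 1, box 0 p, cap 1]
      rfl rfl rfl).trans ?_
    refine (S.ev_remove [cap 0, cap 1, box 4 p, cup 3, box 2 p] [cup 2] 3 [cap 0, cup 0] d
      (hl true) rfl rfl rfl rfl rfl rfl).trans ?_
    refine congrArg _ ?_
    refine (S.ev_isotopic
      (w' := [cap 0, cap 1, box 4 p, cup 3, cap 3, box 4 p, cup 4, cup 2])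
      [] [.exr 6, .exr 5, .zig 4] rfl rfl rfl).trans ?_
    refine (S.ev_remove [cap 0, cap 1, box 4 p, cup 3] [cup 2] 3 [cap 0, box 1 p, cup 1] 1
      hc rfl rfl rfl rfl rfl rfl).trans ((one_smul _ _).trans ?_)
    refine (S.ev_isotopic (w' := [box 0 p])
      [.ex 1, .ex 2, .zig 3, .ex 0, .zig 1] [] rfl rfl rfl).trans (S.ev_box p)
  exact smul_right_injective _ hd (e1.symm.trans (e.trans e2))

theorem star_oneBox (hS : S.IsSubfactor) (hirr : S.IsIrreducible) (hp : S.IsProjection p)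
    (h : S.mul (S.coprod p p) p = S.coprod p p) (h0 : p ≠ 0) :
    star (S.oneBox p) = S.oneBox p := by
  have h1 : star (S.oneBox p) = S.ev 3 false [cap 1, box 2 p, cup 3] := by
    rw [oneBox_eq_ev, S.star_ev rfl rfl]
    simp [Piece.reflect, hp.2]
  have h2 : S.oneBox p =
      S.ev 3 false [cap 3, box 2 (S.ev 2 false [cap 0, cap 1, box 2 p, cup 3, cup 2]), cup 1] := by
    rw [halfTurn_eq_self hS hirr hp h h0, oneBox_eq_ev]
  rw [h1, h2]
  refine Eq.symm ((S.ev_glue [cap 3] [cup 1] 2 [cap 0, cap 1, box 2 p, cup 3, cup 2]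
    rfl rfl rfl).trans ?_)
  exact S.ev_isotopic [.exr 0, .exr 1, .exr 2, .exr 3, .zig 4, .exr 3, .exr 2, .exr 1, .zig 0] []
    rfl rfl rfl

theorem isSupport_zero {n : ℕ} {s : Bool} : S.IsSupport (0 : V n s) 0 :=
  ⟨⟨S.zero_mul 0, star_zero _⟩, S.zero_mul 0, fun q _ _ => S.mul_zero q⟩

theorem IsProjection.isSupport_smul {n : ℕ} {s : Bool} {q : V n s} (hq : S.IsProjection q) {c : ℂ}
    (hc : c ≠ 0) : S.IsSupport (c • q) q := by
  refine ⟨hq, by rw [mul_smul, hq.1], fun r _ h => ?_⟩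
  rw [mul_smul] at h
  exact smul_right_injective _ hc h

theorem IsProjection.isSupport {n : ℕ} {s : Bool} {q : V n s} (hq : S.IsProjection q) :
    S.IsSupport q q :=
  ⟨hq, hq.1, fun _ _ h => h⟩

theorem zero_coprod (a : V 2 false) : S.coprod 0 a = 0 := by
  simpa using S.sub_coprod a a a

theorem partialTr_scalar_ne_zero (hS : S.IsSubfactor) (hp : S.IsProjection p) (h0 : p ≠ 0) {α : ℂ}
    (h₁ : S.partialTr p = α • S.one 1 false) : α ≠ 0 := by
  rintro rfl
  refine h0 (eq_zero_of_tr_star_mul_self hS ?_)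
  rw [hp.2, hp.1, ← tr_partialTr, h₁, tr_smul, zero_smul]

theorem coprod_mul_of_weaker (hp : S.IsProjection p) (h : S.Weaker (S.coprod p p) p) :
    S.mul (S.coprod p p) p = S.coprod p p := by
  obtain ⟨hx, -, r, q, hr, hq, hqr⟩ := h
  have hpq : S.mul p q = q := hq.2.2 p hp hp.1
  have hqp : q = p := by
    have := congrArg star hpq
    rw [star_mul, hp.2, hq.1.2, hq.2.1] at this
    exact this.symm
  have hpx : S.mul p (S.coprod p p) = S.coprod p p := by
    rw [← hr.2.1, ← mul_assoc, ← hqp, hqr]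
  have := congrArg star hpx
  rwa [star_mul, hx, hp.2] at this

theorem coprod_mul_of_isBiprojection (hS : S.IsSubfactor) (hirr : S.IsIrreducible)
    (h : S.IsBiprojection p) : S.mul (S.coprod p p) p = S.coprod p p := by
  obtain ⟨hp, c, z, hz, e⟩ := h
  have : S.coprod p p = c • p := by
    apply oneBox_injective hS hirr
    rw [← oneBox_mul, oneBox_smul, e, smul_mul, mul_smul, hz.1]
  rw [this, smul_mul, hp.1]

variable [∀ n s, StarModule ℂ (V n s)]

theorem star_partialTr_scalar (hirr : S.IsIrreducible) (hp : S.IsProjection p) {α : ℂ}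
    (h₁ : S.partialTr p = α • S.one 1 false) : star α = α := by
  have h : star (S.partialTr p) = S.partialTr p := by
    rw [partialTr, S.star_ev rfl rfl]
    simp [Piece.reflect, hp.2]
  rw [h₁, star_smul, star_one] at h
  exact smul_left_injective ℂ (one_ne_zero hirr false) h

theorem weaker_and_isBiprojection (hS : S.IsSubfactor) (hirr : S.IsIrreducible)
    (hp : S.IsProjection p) (h : S.mul (S.coprod p p) p = S.coprod p p) :
    S.Weaker (S.coprod p p) p ∧ S.IsBiprojection p := by
  by_cases h0 : p = 0
  · subst h0
    have hz : S.IsProjection (S.oneBox (0 : V 2 false)) := by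
      have : S.oneBox (0 : V 2 false) = 0 := by simpa using S.oneBox_smul 0 (0 : V 2 false)
      rw [this]
      exact isSupport_zero.1
    rw [zero_coprod]
    exact ⟨⟨star_zero _, star_zero _, 0, 0, isSupport_zero, isSupport_zero, S.zero_mul 0⟩,
      hp, 1, 0, hz, (one_smul ℂ _).symm⟩
  obtain ⟨α, h₁, h₂⟩ := exists_partialTr hS hirr p
  have hα := partialTr_scalar_ne_zero hS hp h0 h₁
  have hr := star_partialTr_scalar hirr hp h₁
  have e := coprod_self_eq_smul h₁ h₂ hS hirr hp h
  refine ⟨⟨by rw [star_coprod, hp.2], hp.2, p, p, ?_, hp.isSupport, hp.1⟩, hp, α, α⁻¹ • p,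
    ⟨?_, ?_⟩, ?_⟩
  · rw [e]
    exact hp.isSupport_smul hα
  · rw [oneBox_smul, smul_mul, mul_smul, oneBox_mul, e, oneBox_smul, inv_smul_smul₀ hα]
  · rw [oneBox_smul, star_smul, star_oneBox hS hirr hp h h0, star_inv₀, hr]
  · rw [← oneBox_smul, smul_inv_smul₀ hα]

end PlanarStarAlgebra

theorem theorem4p8 {V : ℕ → Bool → Type u} [∀ n s, AddCommGroup (V n s)]
    [∀ n s, Module ℂ (V n s)] [∀ n s, StarAddMonoid (V n s)] [∀ n s, StarModule ℂ (V n s)]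
    (S : PlanarStarAlgebra V) (hS : S.IsSubfactor) (hirr : S.IsIrreducible)
    (P : V 2 false) (hP : S.IsProjection P) :
    (S.Weaker (S.coprod P P) P ↔ S.mul (S.coprod P P) P = S.coprod P P) ∧
      (S.Weaker (S.coprod P P) P ↔ S.IsBiprojection P) := by
  have h1 := PlanarStarAlgebra.coprod_mul_of_weaker hP
  have h2 := PlanarStarAlgebra.weaker_and_isBiprojection hS hirr hP
  have h3 := PlanarStarAlgebra.coprod_mul_of_isBiprojection (p := P) hS hirr
  exact ⟨⟨h1, fun h => (h2 h).1⟩, fun h => (h2 (h1 h)).2, fun h => (h2 (h3 h)).1⟩
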